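/- **Theorem (Multidimensional homogeneous Sárközy).** For a positive integer $N$ write $[N] = \{1, 2, \dots, N\}$. Call a set $B$ of positive integers *$M$-homogeneous* if for every positive integer $q$ we have $$B \cap \{q, 2q, \dots, Mq\} \neq \emptyset.$$ For any real $\delta > 0$ and any positive integers $d, M$ there exists $N_0 = N_0(\delta, d, M)$ such that for any integer $N \geq N_0$ the following holds. If $A \subset [N]^d$ satisfies $|A| \geq \delta N^d$ and $B_1, \dots, B_d$ are $M$-homogeneous sets of positive integers, then there exist $x, x' \in A$ and $y_1 \in B_1, \dots, y_d \in B_d$ such that $$x - x' = (y_1^2, \dots, y_d^2).$$ -/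

import Mathlib

/-- `B` is an `M`-homogeneous set of positive integers: every element of `B` is positive, and `B`
meets every homogeneous progression `q · [M] = {q, 2q, …, Mq}` with `q` a positive integer. -/
def IsHomogeneousSet (M : ℕ) (B : Set ℕ) : Prop :=
  (∀ b ∈ B, 0 < b) ∧ ∀ q : ℕ, 0 < q → (B ∩ {n : ℕ | ∃ m ∈ Finset.Icc 1 M, n = q * m}).Nonempty

/-- The grid `[N]^d = {1, …, N}^d`, as a set of integer vectors. -/
noncomputable def grid (d N : ℕ) : Finset (Fin d → ℤ) :=
  Fintype.piFinset fun _ => Finset.Icc (1 : ℤ) (N : ℤ)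

section
open Finset
open scoped ComplexConjugate

/-! If `A` has no such pair, then ∑_r |Â(r)|² ∏_i W_i(r_i) = 0 whenever each W_i averages z^(b²)
over elements b of B_i that are small compared with N. Frequency 0 contributes |A|², so the product
must not be too negative elsewhere. To ensure this, k such identities are added, with averages
arranged (`exists_squareAvg_chain`) so that wherever one has norm at least η, all later ones are
close to 1. At every frequency the products then sum to at least -(kη + 1) in real part
(`neg_le_sum_re_prod_of_chain`), against k at frequency 0. Parseval yields kδ ≤ (kη + 1)2^d, which
is false for small η and large k.

The chain rests on `exists_square_power_near_one_on_spectrum`. Homogeneity only supplies elements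
m(p)(p₁ + p₂ + 1) of B with m(p) in [1, M] uncontrolled. A large sieve still confines the large
spectrum to boundedly many translates of a neighbourhood of roots of unity, and recurrence along
squares gives a bounded r with z^(r²) near 1 on all of it. Later averages use multiples of r. -/

/-! ### Unimodular powers and the dual large sieve -/

theorem norm_pow_sub_one_le {z : ℂ} (hz : ‖z‖ = 1) (n : ℕ) :
    ‖z ^ n - 1‖ ≤ n * ‖z - 1‖ := by
  rw [← geom_sum_mul, norm_mul]
  gcongr
  refine (norm_sum_le _ _).trans ?_
  simp [hz]

theorem norm_geom_sum_mul_le {z : ℂ} (hz : ‖z‖ = 1) (n : ℕ) :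
    ‖∑ a ∈ range n, z ^ a‖ * ‖z - 1‖ ≤ 2 := by
  rw [← norm_mul, geom_sum_mul]
  refine (norm_sub_le _ _).trans ?_
  simp [hz]; norm_num

theorem mul_conj_eq_one {z : ℂ} (hz : ‖z‖ = 1) : z * conj z = 1 := by
  rw [Complex.mul_conj, Complex.normSq_eq_norm_sq, hz]; simp

/-- The dual form of the large sieve. -/
theorem sum_norm_sq_le_sum_norm_inner {σ κ : Type*} (S : Finset σ) (Z : Finset κ) (c : κ → ℂ)
    (hc : ∀ k ∈ Z, ‖c k‖ ≤ 1) (f : κ → σ → ℂ) :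
    ∑ s ∈ S, ‖∑ k ∈ Z, c k * f k s‖ ^ 2 ≤
      ∑ k ∈ Z, ∑ l ∈ Z, ‖∑ s ∈ S, f k s * conj (f l s)‖ := by
  have h1 : ((∑ s ∈ S, ‖∑ k ∈ Z, c k * f k s‖ ^ 2 : ℝ) : ℂ) =
      ∑ k ∈ Z, ∑ l ∈ Z, (c k * conj (c l)) * ∑ s ∈ S, f k s * conj (f l s) := by
    push_cast
    simp_rw [← Complex.mul_conj', map_sum, sum_mul_sum, mul_sum]
    rw [sum_comm]
    refine sum_congr rfl fun k _ => ?_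
    rw [sum_comm]
    refine sum_congr rfl fun l _ => sum_congr rfl fun s _ => ?_
    simp only [map_mul]; ring
  have h2 : ∑ s ∈ S, ‖∑ k ∈ Z, c k * f k s‖ ^ 2 =
      ‖((∑ s ∈ S, ‖∑ k ∈ Z, c k * f k s‖ ^ 2 : ℝ) : ℂ)‖ := by
    rw [Complex.norm_real, Real.norm_of_nonneg (sum_nonneg fun _ _ => by positivity)]
  rw [h2, h1]
  refine norm_sum_le_of_le _ fun k hk => norm_sum_le_of_le _ fun l hl => ?_
  rw [norm_mul, norm_mul, Complex.norm_conj]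
  exact mul_le_of_le_one_left (norm_nonneg _)
    (mul_le_one₀ (hc k hk) (norm_nonneg _) (hc l hl))

/-! ### Bilinear quadratic Weyl sums -/

theorem exists_close_pair {X D : ℕ} (hD : 0 < D) {H : Finset ℕ} (hH : H ⊆ range X)
    (hcard : X / D + 1 < H.card) : ∃ a ∈ H, ∃ b ∈ H, a < b ∧ b - a ≤ D := by
  have hmap : ∀ a ∈ H, a / D ∈ range (X / D + 1) := fun a ha => by
    have := mem_range.1 (hH ha)
    exact mem_range.2 (Nat.lt_succ_of_le (Nat.div_le_div_right this.le))
  obtain ⟨a, ha, b, hb, hab, he⟩ := exists_ne_map_eq_of_card_lt_of_maps_to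
    (by simpa using hcard) hmap
  have key : ∀ a b : ℕ, a / D = b / D → b - a ≤ D := fun a b h => by
    have h1 := Nat.div_add_mod a D
    have h2 := Nat.div_add_mod b D
    have h3 := Nat.mod_lt b hD
    rw [h] at h1
    omega
  rcases lt_or_gt_of_ne hab with h | h
  · exact ⟨a, ha, b, hb, h, key a b he⟩
  · exact ⟨b, hb, a, ha, h, key b a he.symm⟩

/-- If a bilinear quadratic exponential sum is large at `z`, then a bounded power of `z` is close
to `1`. -/
theorem exists_pow_near_one_of_large_weyl_sum {η : ℝ} (hη : 0 < η) :
    ∃ q : ℕ, 0 < q ∧ ∃ C : ℝ, 0 ≤ C ∧ ∀ X : ℕ, 0 < X → ∀ z : ℂ, ‖z‖ = 1 →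
      η * (X : ℝ) ^ 2 ≤ ‖∑ p ∈ range X ×ˢ range X, z ^ ((p.1 + p.2 + 1) ^ 2)‖ →
        ‖z ^ q - 1‖ ≤ C / X := by
  -- At least η²X/2 exponents below X will be good, so two of them differ by at most D; any such gap
  -- divides D!.
  obtain ⟨D, hD⟩ := exists_nat_gt (4 / η ^ 2)
  have hD0 : (0 : ℝ) < D := lt_trans (by positivity) hD
  have hDpos : 0 < D := by exact_mod_cast hD0
  refine ⟨2 * D.factorial, by positivity, 8 / η ^ 2 * D.factorial, by positivity, ?_⟩
  intro X hX z hz hlarge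
  have hX0 : (0 : ℝ) < X := by exact_mod_cast hX
  have hfac : (1 : ℝ) ≤ D.factorial := by exact_mod_cast Nat.factorial_pos D
  rcases le_or_gt (X : ℝ) (4 / η ^ 2) with hsmall | hbig
  · have h2 : ‖z ^ (2 * D.factorial) - 1‖ ≤ 2 := by
      refine (norm_sub_le _ _).trans ?_
      simp [hz]; norm_num
    refine h2.trans ?_
    rw [le_div_iff₀ hX0]
    have : 8 / η ^ 2 = 2 * (4 / η ^ 2) := by ring
    nlinarith [show 0 < 4 / η ^ 2 by positivity]
  set G : ℕ → ℕ → ℝ := fun h l =>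
    ‖∑ a ∈ range X, z ^ (2 * a * h) * conj (z ^ (2 * a * l))‖ with hG
  have hsum : η ^ 2 * (X : ℝ) ^ 3 ≤ ∑ h ∈ range X, ∑ l ∈ range X, G h l := by
    have h0 := sum_norm_sq_le_sum_norm_inner (range X) (range X) (fun h => z ^ (h ^ 2 + 2 * h))
      (fun k _ => by simp [hz]) (fun h a => z ^ (2 * a * h))
    have h1 : ‖∑ p ∈ range X ×ˢ range X, z ^ ((p.1 + p.2 + 1) ^ 2)‖ ≤
        ∑ a ∈ range X, ‖∑ h ∈ range X, z ^ (h ^ 2 + 2 * h) * z ^ (2 * a * h)‖ := by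
      rw [sum_product]
      refine norm_sum_le_of_le _ fun a _ => ?_
      -- Only the term 2ah couples the two variables, so one use of the large sieve leaves geometric
      -- sums.
      have : ∑ h ∈ range X, z ^ ((a + h + 1) ^ 2) =
          z ^ ((a + 1) ^ 2) * ∑ h ∈ range X, z ^ (h ^ 2 + 2 * h) * z ^ (2 * a * h) := by
        rw [mul_sum]
        refine sum_congr rfl fun h _ => ?_
        rw [← pow_add, ← pow_add]; congr 1; ring
      simp only [this, norm_mul, norm_pow, hz, one_pow, one_mul, le_refl]
    have h2 := sq_sum_le_card_mul_sum_sq (s := range X)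
      (f := fun a => ‖∑ h ∈ range X, z ^ (h ^ 2 + 2 * h) * z ^ (2 * a * h)‖)
    rw [card_range] at h2
    have h3 : (η * (X : ℝ) ^ 2) ^ 2 ≤ X * ∑ h ∈ range X, ∑ l ∈ range X, G h l := by
      refine (pow_le_pow_left₀ (by positivity) (hlarge.trans h1) 2).trans (h2.trans ?_)
      gcongr
    have h4 : (X : ℝ) * (η ^ 2 * (X : ℝ) ^ 3) ≤ X * ∑ h ∈ range X, ∑ l ∈ range X, G h l := by
      calc _ = (η * (X : ℝ) ^ 2) ^ 2 := by ring
        _ ≤ _ := h3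
    exact le_of_mul_le_mul_left h4 hX0
  obtain ⟨h, -, hh⟩ : ∃ h ∈ range X, η ^ 2 * (X : ℝ) ^ 2 ≤ ∑ l ∈ range X, G h l := by
    by_contra! hcon
    have := sum_lt_sum_of_nonempty (nonempty_range_iff.2 hX.ne') hcon
    simp only [sum_const, card_range, nsmul_eq_mul] at this
    nlinarith
  have hGle : ∀ l, G h l ≤ X := fun l => by
    refine (norm_sum_le _ _).trans ?_
    simp [hz]
  set H := (range X).filter fun l => η ^ 2 / 2 * X ≤ G h l with hH
  have hHcard : η ^ 2 / 2 * X ≤ H.card := by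
    have h1 : ∑ l ∈ range X, G h l ≤ ∑ l ∈ range X,
        ((if η ^ 2 / 2 * X ≤ G h l then (X : ℝ) else 0) + η ^ 2 / 2 * X) := by
      refine sum_le_sum fun l _ => ?_
      split_ifs with hc
      · have := hGle l
        have : 0 ≤ η ^ 2 / 2 * X := by positivity
        linarith
      · push Not at hc; linarith
    rw [sum_add_distrib, ← sum_filter, ← hH] at h1
    simp only [sum_const, card_range, nsmul_eq_mul] at h1
    have : X * (η ^ 2 / 2 * X) ≤ X * (H.card : ℝ) := by nlinarith
    exact le_of_mul_le_mul_left this hX0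
  have hclose : ∀ l ∈ H, ‖z ^ (2 * h) - z ^ (2 * l)‖ ≤ 4 / η ^ 2 / X := by
    intro l hl
    have hl' := (mem_filter.1 hl).2
    set u := z ^ (2 * h) * conj (z ^ (2 * l)) with hu
    have hu1 : ‖u‖ = 1 := by simp [hu, hz]
    have hsumu : G h l = ‖∑ a ∈ range X, u ^ a‖ := by
      simp only [hG, hu]
      congr 1
      refine sum_congr rfl fun a _ => ?_
      rw [mul_pow, ← map_pow, ← pow_mul, ← pow_mul]
      congr 2 <;> [skip; congr 1] <;> ring
    have hgs := norm_geom_sum_mul_le hu1 X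
    rw [← hsumu] at hgs
    have h1 : η ^ 2 / 2 * X * ‖u - 1‖ ≤ 2 :=
      (mul_le_mul_of_nonneg_right hl' (norm_nonneg _)).trans hgs
    have h2 : ‖z ^ (2 * h) - z ^ (2 * l)‖ = ‖u - 1‖ := by
      have : z ^ (2 * h) - z ^ (2 * l) = (u - 1) * z ^ (2 * l) := by
        have hc : z ^ (2 * l) * conj (z ^ (2 * l)) = 1 := mul_conj_eq_one (by simp [hz])
        rw [hu]; linear_combination (-z ^ (2 * h)) * hc
      rw [this, norm_mul]; simp [hz]
    rw [h2, div_div, le_div_iff₀ (by positivity)]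
    linarith
  obtain ⟨a, ha, b, hb, hab, hba⟩ := exists_close_pair hDpos (H := H) (filter_subset _ _) (by
    have h1 : ((X / D : ℕ) : ℝ) ≤ X / D := Nat.cast_div_le
    have h2 : (X : ℝ) / D ≤ η ^ 2 / 4 * X := by
      rw [div_lt_iff₀ (by positivity)] at hD
      rw [div_le_iff₀ hD0]
      nlinarith
    have h3 : 1 < η ^ 2 / 4 * X := by
      rw [div_lt_iff₀ (by positivity)] at hbig
      linarith
    have : ((X / D : ℕ) : ℝ) + 1 < H.card := by linarith
    exact_mod_cast this)
  have hdist : ‖z ^ (2 * (b - a)) - 1‖ ≤ 8 / η ^ 2 / X := by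
    have h1 : ‖z ^ (2 * (b - a)) - 1‖ = ‖z ^ (2 * b) - z ^ (2 * a)‖ := by
      have : z ^ (2 * b) - z ^ (2 * a) = (z ^ (2 * (b - a)) - 1) * z ^ (2 * a) := by
        rw [sub_mul, ← pow_add, one_mul]; congr 2; omega
      rw [this, norm_mul]; simp [hz]
    rw [h1]
    calc ‖z ^ (2 * b) - z ^ (2 * a)‖
        = ‖(z ^ (2 * h) - z ^ (2 * a)) - (z ^ (2 * h) - z ^ (2 * b))‖ := by congr 1; ring
      _ ≤ 4 / η ^ 2 / X + 4 / η ^ 2 / X :=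
          (norm_sub_le _ _).trans (add_le_add (hclose a ha) (hclose b hb))
      _ = _ := by ring
  obtain ⟨e, he⟩ : (b - a) ∣ D.factorial := Nat.dvd_factorial (by omega) hba
  have hele : e ≤ D.factorial := by
    rw [he]; exact Nat.le_mul_of_pos_left _ (by omega)
  calc ‖z ^ (2 * D.factorial) - 1‖ = ‖(z ^ (2 * (b - a))) ^ e - 1‖ := by
        rw [← pow_mul, he, mul_assoc]
    _ ≤ e * ‖z ^ (2 * (b - a)) - 1‖ := norm_pow_sub_one_le (by simp [hz]) _
    _ ≤ D.factorial * (8 / η ^ 2 / X) := by gcongr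
    _ = _ := by ring

/-! ### The large spectrum of square averages -/

/-- The average of `z ^ (b p) ^ 2` over the square `[0, X)²`. -/
noncomputable def squareAvg (X : ℕ) (b : ℕ × ℕ → ℕ) (z : ℂ) : ℂ :=
  (∑ p ∈ range X ×ˢ range X, z ^ (b p ^ 2)) / (X : ℂ) ^ 2

/-- Phases c(z) turn ∑ |W(z)| into one double sum, to which Cauchy–Schwarz in p and the dual large
sieve apply. After division by X⁴ the diagonal gives M|Z| and the rest at most η²|Z|²/2, half of the
left side η²|Z|². -/
theorem card_le_of_separated {η : ℝ} (hη : 0 < η) {M X : ℕ} (hX : 0 < X)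
    {m : ℕ × ℕ → ℕ} (hm : ∀ p, m p ∈ Icc 1 M) (Z : Finset ℂ)
    (hZ1 : ∀ z ∈ Z, ‖z‖ = 1)
    (hZ : ∀ z ∈ Z, η ≤ ‖squareAvg X (fun p => m p * (p.1 + p.2 + 1)) z‖)
    (hsep : ∀ z ∈ Z, ∀ w ∈ Z, z ≠ w → ∀ μ ∈ Icc 1 M,
      ‖∑ p ∈ range X ×ˢ range X, ((z * conj w) ^ (μ ^ 2)) ^ ((p.1 + p.2 + 1) ^ 2)‖ ≤
        η ^ 2 / (2 * M) * (X : ℝ) ^ 2) :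
    (Z.card : ℝ) ≤ 2 * M / η ^ 2 := by
  have hX0 : (0 : ℝ) < X := by exact_mod_cast hX
  have hM0 : (0 : ℝ) < M := by
    have := mem_Icc.1 (hm (0, 0))
    exact_mod_cast this.1.trans this.2
  set S := range X ×ˢ range X
  have hS : (S.card : ℝ) = (X : ℝ) ^ 2 := by simp [S, card_product]; ring
  set W : ℂ → ℂ := squareAvg X (fun p => m p * (p.1 + p.2 + 1)) with hW
  set c : ℂ → ℂ := fun z => conj (W z) / ‖W z‖ with hc
  have hcW : ∀ z ∈ Z, c z * W z = ‖W z‖ := fun z hz => by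
    have : (‖W z‖ : ℂ) ≠ 0 := by
      exact_mod_cast (hη.trans_le (hZ z hz)).ne'
    rw [hc]; field_simp; rw [mul_comm, Complex.mul_conj']
  have hc1 : ∀ z ∈ Z, ‖c z‖ ≤ 1 := fun z hz => by
    simp only [hc, norm_div, Complex.norm_conj, Complex.norm_real, norm_norm]
    exact div_self_le_one _
  have h1 : η * Z.card * (X : ℝ) ^ 2 ≤
      ∑ p ∈ S, ‖∑ z ∈ Z, c z * z ^ ((m p * (p.1 + p.2 + 1)) ^ 2)‖ := by
    have h2 : ∑ p ∈ S, ∑ z ∈ Z, c z * z ^ ((m p * (p.1 + p.2 + 1)) ^ 2) =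
        ((∑ z ∈ Z, ‖W z‖ : ℝ) : ℂ) * (X : ℂ) ^ 2 := by
      rw [sum_comm]
      push_cast
      rw [sum_mul]
      refine sum_congr rfl fun z hz => ?_
      rw [← hcW z hz, ← mul_sum, mul_assoc]
      congr 1
      rw [hW, squareAvg, div_mul_cancel₀]
      exact pow_ne_zero _ (by exact_mod_cast hX.ne')
    refine le_trans ?_ (norm_sum_le _ _)
    rw [h2, norm_mul, Complex.norm_real, norm_pow, Complex.norm_natCast]
    gcongr
    rw [Real.norm_of_nonneg (sum_nonneg fun _ _ => norm_nonneg _)]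
    have := card_nsmul_le_sum Z (fun z => ‖W z‖) η hZ
    rw [nsmul_eq_mul] at this
    linarith
  -- Squares are nonnegative, so the arbitrary multiplier m(p) may be replaced by a sum over all μ,
  -- at the cost of a factor M.
  have h3 : ∑ p ∈ S, ‖∑ z ∈ Z, c z * z ^ ((m p * (p.1 + p.2 + 1)) ^ 2)‖ ^ 2 ≤
      ∑ μ ∈ Icc 1 M, ∑ p ∈ S, ‖∑ z ∈ Z, c z * z ^ ((μ * (p.1 + p.2 + 1)) ^ 2)‖ ^ 2 := by
    rw [sum_comm]
    refine sum_le_sum fun p _ => ?_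
    exact single_le_sum (f := fun μ => ‖∑ z ∈ Z, c z * z ^ ((μ * (p.1 + p.2 + 1)) ^ 2)‖ ^ 2)
      (fun _ _ => by positivity) (hm p)
  have h4 : ∀ μ ∈ Icc 1 M, ∑ p ∈ S, ‖∑ z ∈ Z, c z * z ^ ((μ * (p.1 + p.2 + 1)) ^ 2)‖ ^ 2 ≤
      Z.card * (X : ℝ) ^ 2 + Z.card ^ 2 * (η ^ 2 / (2 * M) * (X : ℝ) ^ 2) := by
    intro μ hμ
    refine (sum_norm_sq_le_sum_norm_inner S Z c hc1
      (fun z p => z ^ ((μ * (p.1 + p.2 + 1)) ^ 2))).trans ?_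
    have h5 : ∀ z ∈ Z, ∀ w ∈ Z,
        ‖∑ p ∈ S, z ^ ((μ * (p.1 + p.2 + 1)) ^ 2) * conj (w ^ ((μ * (p.1 + p.2 + 1)) ^ 2))‖ ≤
          (if z = w then (X : ℝ) ^ 2 else 0) + η ^ 2 / (2 * M) * (X : ℝ) ^ 2 := by
      intro z hz w hw
      split_ifs with hzw
      · refine le_add_of_le_of_nonneg ((norm_sum_le _ _).trans ?_) (by positivity)
        simp [hZ1 z hz, hZ1 w hw, hS]
      · rw [zero_add]
        refine le_trans (le_of_eq ?_) (hsep z hz w hw hzw μ hμ)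
        congr 1
        refine sum_congr rfl fun p _ => ?_
        rw [map_pow, ← mul_pow, ← pow_mul, ← mul_pow]
    refine (sum_le_sum fun z hz => sum_le_sum fun w hw => h5 z hz w hw).trans (le_of_eq ?_)
    simp only [sum_add_distrib, sum_ite_eq, sum_const, nsmul_eq_mul, sum_ite_mem, inter_self]
    ring
  have h6 := sq_sum_le_card_mul_sum_sq (s := S)
    (f := fun p => ‖∑ z ∈ Z, c z * z ^ ((m p * (p.1 + p.2 + 1)) ^ 2)‖)
  have h7 := h3.trans (sum_le_sum h4)
  rw [sum_const, Nat.card_Icc, nsmul_eq_mul, Nat.add_sub_cancel] at h7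
  have h8 : (η * Z.card * (X : ℝ) ^ 2) ^ 2 ≤ (X : ℝ) ^ 2 *
      (M * (Z.card * (X : ℝ) ^ 2 + Z.card ^ 2 * (η ^ 2 / (2 * M) * (X : ℝ) ^ 2))) := by
    refine (pow_le_pow_left₀ (by positivity) h1 2).trans (h6.trans ?_)
    rw [hS]
    gcongr
  rcases Z.card.eq_zero_or_pos with h0 | h0
  · rw [h0]; simp; positivity
  have hK : (0 : ℝ) < Z.card := by exact_mod_cast h0
  have h9 : (X : ℝ) ^ 4 * Z.card * (η ^ 2 * Z.card) ≤
      (X : ℝ) ^ 4 * Z.card * (M + η ^ 2 / 2 * Z.card) := by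
    calc _ = (η * Z.card * (X : ℝ) ^ 2) ^ 2 := by ring
      _ ≤ _ := h8
      _ = _ := by field_simp
  have h10 := le_of_mul_le_mul_left h9 (by positivity)
  rw [le_div_iff₀ (by positivity)]
  linarith

/-- The large spectrum of a square average is covered by boundedly many translates of a
neighbourhood of a group of roots of unity. -/
theorem exists_spectrum_cover {η : ℝ} (hη : 0 < η) {M : ℕ} (hM : 0 < M) :
    ∃ K q : ℕ, 0 < q ∧ ∃ C : ℝ, 0 ≤ C ∧ ∀ X : ℕ, 0 < X → ∀ m : ℕ × ℕ → ℕ,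
      (∀ p, m p ∈ Icc 1 M) → ∃ Z : Finset ℂ, Z.card ≤ K ∧ (∀ z ∈ Z, ‖z‖ = 1) ∧
        ∀ z : ℂ, ‖z‖ = 1 → η ≤ ‖squareAvg X (fun p => m p * (p.1 + p.2 + 1)) z‖ →
          ∃ w ∈ Z, ‖(z * conj w) ^ q - 1‖ ≤ C / X := by
  classical
  have hM0 : (0 : ℝ) < M := by exact_mod_cast hM
  obtain ⟨q, hq, C, hC, hweyl⟩ := exists_pow_near_one_of_large_weyl_sum
    (η := η ^ 2 / (2 * M)) (by positivity)
  refine ⟨⌊2 * M / η ^ 2⌋₊, M.factorial ^ 2 * q, by positivity, M.factorial ^ 2 * C,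
    by positivity, fun X hX m hm => ?_⟩
  set close : ℂ → ℂ → Prop := fun z w =>
    ‖(z * conj w) ^ (M.factorial ^ 2 * q) - 1‖ ≤ M.factorial ^ 2 * C / X with hclose
  set good : Finset ℂ → Prop := fun Z => (∀ z ∈ Z, ‖z‖ = 1 ∧
    η ≤ ‖squareAvg X (fun p => m p * (p.1 + p.2 + 1)) z‖) ∧
    ∀ z ∈ Z, ∀ w ∈ Z, z ≠ w → ¬ close z w with hgood
  have hsymm : ∀ z w, close z w → close w z := by
    intro z w h
    have : (w * conj z) ^ (M.factorial ^ 2 * q) - 1 =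
        conj ((z * conj w) ^ (M.factorial ^ 2 * q) - 1) := by
      simp [mul_comm]
    simp only [hclose] at h ⊢
    rwa [this, Complex.norm_conj]
  have hbound : ∀ Z, good Z → Z.card ≤ ⌊2 * M / η ^ 2⌋₊ := by
    intro Z hZ
    refine Nat.le_floor (card_le_of_separated hη hX hm Z (fun z hz => (hZ.1 z hz).1)
      (fun z hz => (hZ.1 z hz).2) ?_)
    intro z hz w hw hzw μ hμ
    by_contra! hcon
    refine hZ.2 z hz w hw hzw ?_
    have hu : ‖z * conj w‖ = 1 := by simp [(hZ.1 z hz).1, (hZ.1 w hw).1]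
    have h1 := hweyl X hX ((z * conj w) ^ (μ ^ 2)) (by rw [norm_pow, hu, one_pow]) hcon.le
    obtain ⟨hμ1, hμM⟩ := mem_Icc.1 hμ
    obtain ⟨e, he⟩ : μ ∣ M.factorial := Nat.dvd_factorial hμ1 hμM
    have hele : e ≤ M.factorial := by
      rw [he]; exact Nat.le_mul_of_pos_left _ hμ1
    calc ‖(z * conj w) ^ (M.factorial ^ 2 * q) - 1‖
        = ‖(((z * conj w) ^ (μ ^ 2)) ^ q) ^ (e ^ 2) - 1‖ := by
          rw [← pow_mul, ← pow_mul, he]; congr 3; ring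
      _ ≤ (e ^ 2 : ℕ) * ‖((z * conj w) ^ (μ ^ 2)) ^ q - 1‖ :=
          norm_pow_sub_one_le (by rw [norm_pow, norm_pow, hu, one_pow, one_pow]) _
      _ ≤ (M.factorial ^ 2 : ℕ) * (C / X) := by gcongr
      _ = _ := by push_cast; ring
  -- A separated set of maximal size covers the spectrum, since an uncovered point could be added to
  -- it.
  obtain ⟨n, ⟨Z, hZ, hZn⟩, hmax⟩ : ∃ n, (∃ Z, good Z ∧ Z.card = n) ∧
      ∀ Z, good Z → Z.card ≤ n := by
    have hex : ∃ n, ∀ Z, good Z → Z.card ≤ n := ⟨_, hbound⟩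
    refine ⟨Nat.find hex, ?_, Nat.find_spec hex⟩
    by_contra! hcon
    rcases Nat.eq_zero_or_pos (Nat.find hex) with h0 | h0
    · exact hcon ∅ (by simp [hgood]) (by simp [h0])
    · refine Nat.find_min hex (Nat.sub_lt h0 one_pos) fun Z hZ => ?_
      have h1 := Nat.find_spec hex Z hZ
      have h2 := hcon Z hZ
      omega
  refine ⟨Z, hbound Z hZ, fun z hz => (hZ.1 z hz).1, fun z hz hzl => ?_⟩
  by_contra! hcon
  have hfar : ∀ w ∈ Z, ¬ close z w := fun w hw => not_le.2 (hcon w hw)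
  have hzZ : z ∉ Z := fun hmem => hfar z hmem (by
    simp only [hclose, mul_conj_eq_one hz]; simp; positivity)
  have := hmax (insert z Z) ⟨fun w hw => by
    rcases mem_insert.1 hw with rfl | hw
    · exact ⟨hz, hzl⟩
    · exact hZ.1 w hw, fun u hu w hw huw => by
    rcases mem_insert.1 hu with hu | hu <;> rcases mem_insert.1 hw with hw | hw
    · exact absurd (hu.trans hw.symm) huw
    · exact hu ▸ hfar w hw
    · exact fun h => hfar u hu (hsymm _ _ (hw ▸ h))
    · exact hZ.2 u hu w hw huw⟩
  rw [card_insert_of_notMem hzZ] at this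
  omega

/-! ### Recurrence along squares -/

/-- Hales–Jewett on words over {0, 1, 2}, coloured by a small ball containing z^(s²) for the digit
sum s: a monochromatic line gives sums b, b + d, b + 2d, and the second difference of their squares
is 2d². The bound depends only on the word length, hence not on z. -/
theorem exists_bounded_square_recurrence {ε : ℝ} (hε : 0 < ε) :
    ∃ Q : ℕ, ∀ z : ℂ, ‖z‖ = 1 → ∃ q : ℕ, 0 < q ∧ q ≤ Q ∧ ‖z ^ (q ^ 2) - 1‖ ≤ ε := by
  classical
  obtain ⟨t, -, htf, htc⟩ := finite_cover_balls_of_compact (isCompact_sphere (0 : ℂ) 1)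
    (e := ε / 8) (by positivity)
  have hcol : ∀ u : ℂ, ‖u‖ = 1 → ∃ c : t, ‖u - c‖ < ε / 8 := fun u hu => by
    obtain ⟨c, hc, hcu⟩ := Set.mem_iUnion₂.1 (htc (show u ∈ Metric.sphere (0 : ℂ) 1 by simpa using hu))
    exact ⟨⟨c, hc⟩, by simpa [dist_eq_norm] using hcu⟩
  have : Nonempty t := ⟨(hcol 1 (by simp)).choose⟩
  choose! col hcol using hcol
  have : Finite t := htf
  obtain ⟨ι, hι, hHJ⟩ := Combinatorics.Line.exists_mono_in_high_dimension (Fin 3) t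
  refine ⟨2 * Fintype.card ι, fun z hz => ?_⟩
  have hzn : ∀ n, ‖z ^ n‖ = 1 := fun n => by simp [hz]
  obtain ⟨l, c, hc⟩ := hHJ fun v => col (z ^ ((∑ i, (v i : ℕ)) ^ 2))
  set D : Finset ι := {i | l.idxFun i = none} with hD
  have hDpos : 0 < D.card := card_pos.2 (l.proper.imp fun i hi => by simp [hD, hi])
  have hline : ∀ x : Fin 3, ∑ i, (l x i : ℕ) =
      ∑ i ∈ Dᶜ, (l 0 i : ℕ) + x * D.card := fun x => by
    rw [← sum_compl_add_sum D]
    congr 1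
    · refine sum_congr rfl fun i hi => ?_
      have hi' : l.idxFun i ≠ none := by simpa [hD] using hi
      obtain ⟨a, ha⟩ := Option.ne_none_iff_exists'.1 hi'
      rw [l.apply_some ha, l.apply_some ha]
    · rw [sum_congr rfl fun i hi => ?_, sum_const, smul_eq_mul, mul_comm]
      rw [l.apply_none x i (by simpa [hD] using hi)]
  set b := ∑ i ∈ Dᶜ, (l 0 i : ℕ)
  set d := D.card
  have hnear : ∀ x : Fin 3, ‖z ^ ((b + x * d) ^ 2) - c‖ < ε / 8 := fun x => by
    have h1 := hcol (z ^ ((∑ i, (l x i : ℕ)) ^ 2)) (hzn _)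
    have h2 : col (z ^ ((∑ i, (l x i : ℕ)) ^ 2)) = c := hc x
    rwa [h2, hline] at h1
  have hdist : ∀ x y : Fin 3, ‖z ^ ((b + x * d) ^ 2) - z ^ ((b + y * d) ^ 2)‖ ≤ ε / 4 :=
    fun x y => by
      calc _ = ‖(z ^ ((b + x * d) ^ 2) - c) - (z ^ ((b + y * d) ^ 2) - c)‖ := by congr 1; ring
        _ ≤ ε / 8 + ε / 8 := (norm_sub_le _ _).trans (add_le_add (hnear x).le (hnear y).le)
        _ = _ := by ring
  have h02 := hdist 0 1
  have h12 := hdist 2 1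
  simp only [Fin.isValue, Fin.val_zero, Fin.val_one, Fin.val_two, zero_mul, one_mul,
    add_zero] at h02 h12
  have h3 : ‖z ^ (2 * d ^ 2) - 1‖ ≤ ε / 2 := by
    have h4 : (z ^ (2 * d ^ 2) - 1) * (z ^ ((b + d) ^ 2)) ^ 2 =
        (z ^ ((b + 2 * d) ^ 2) - z ^ ((b + d) ^ 2)) * z ^ (b ^ 2) +
          z ^ ((b + d) ^ 2) * (z ^ (b ^ 2) - z ^ ((b + d) ^ 2)) := by
      have : z ^ ((b + 2 * d) ^ 2) * z ^ (b ^ 2) =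
          z ^ (2 * d ^ 2) * (z ^ ((b + d) ^ 2)) ^ 2 := by
        rw [← pow_mul, ← pow_add, ← pow_add]; congr 1; ring
      linear_combination -this
    have h5 := congrArg norm h4
    rw [norm_mul, norm_pow, hzn, one_pow, mul_one] at h5
    rw [h5]
    refine (norm_add_le _ _).trans ?_
    rw [norm_mul, norm_mul, hzn, hzn]
    linarith
  refine ⟨2 * d, by omega, by gcongr; exact card_le_univ D, ?_⟩
  have h6 : z ^ ((2 * d) ^ 2) = (z ^ (2 * d ^ 2)) ^ 2 := by rw [← pow_mul]; congr 1; ring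
  rw [h6]
  refine (norm_pow_sub_one_le (hzn _) 2).trans ?_
  push_cast; linarith

theorem exists_bounded_simultaneous_square_recurrence (K : ℕ) :
    ∀ ε : ℝ, 0 < ε → ∃ Q : ℕ, ∀ Z : Finset ℂ, Z.card ≤ K → (∀ z ∈ Z, ‖z‖ = 1) →
      ∃ q : ℕ, 0 < q ∧ q ≤ Q ∧ ∀ z ∈ Z, ‖z ^ (q ^ 2) - 1‖ ≤ ε := by
  classical
  induction K with
  | zero =>
    refine fun ε hε => ⟨1, fun Z hZ _ => ⟨1, one_pos, le_rfl, ?_⟩⟩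
    rw [card_eq_zero.1 (Nat.le_zero.1 hZ)]; simp
  | succ K ih =>
    intro ε hε
    obtain ⟨Q₁, h₁⟩ := exists_bounded_square_recurrence hε
    have hQ₁ : (0 : ℝ) < Q₁ := by
      obtain ⟨q, hq, hqQ, -⟩ := h₁ 1 (by simp)
      exact_mod_cast hq.trans_le hqQ
    -- This tolerance survives a further power q₁² ≤ Q₁², needed for the one remaining point.
    obtain ⟨Q₂, h₂⟩ := ih (ε / Q₁ ^ 2) (by positivity)
    refine ⟨Q₂ * Q₁, fun Z hZ hZ1 => ?_⟩
    obtain ⟨w, Z', hw1, hZ', hcard, hsub⟩ : ∃ (w : ℂ) (Z' : Finset ℂ), ‖w‖ = 1 ∧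
        (∀ z ∈ Z', ‖z‖ = 1) ∧ Z'.card ≤ K ∧ ∀ z ∈ Z, z = w ∨ z ∈ Z' := by
      rcases Z.eq_empty_or_nonempty with rfl | ⟨w, hw⟩
      · exact ⟨1, ∅, by simp, by simp, by simp, by simp⟩
      · refine ⟨w, Z.erase w, hZ1 w hw, fun z hz => hZ1 z (mem_of_mem_erase hz), ?_, ?_⟩
        · rw [card_erase_of_mem hw]; omega
        · intro z hz
          by_cases h : z = w
          · exact .inl h
          · exact .inr (mem_erase.2 ⟨h, hz⟩)
    obtain ⟨q₂, hq₂, hqQ₂, hr₂⟩ := h₂ Z' hcard hZ'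
    obtain ⟨q₁, hq₁, hqQ₁, hr₁⟩ := h₁ (w ^ (q₂ ^ 2)) (by simp [hw1])
    refine ⟨q₂ * q₁, by positivity, by gcongr, fun z hz => ?_⟩
    rw [mul_pow, pow_mul]
    rcases hsub z hz with rfl | hz
    · exact hr₁
    · refine (norm_pow_sub_one_le (by simp [hZ' z hz]) _).trans ?_
      calc ((q₁ ^ 2 : ℕ) : ℝ) * ‖z ^ (q₂ ^ 2) - 1‖ ≤ (Q₁ ^ 2 : ℕ) * (ε / Q₁ ^ 2) := by
            gcongr
            exact hr₂ z hz
        _ = ε := by push_cast; field_simp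

/-- A bounded power trivializes the large spectrum of any square average over multiples. -/
theorem exists_square_power_near_one_on_spectrum {η : ℝ} (hη : 0 < η) {M : ℕ} (hM : 0 < M)
    {ε : ℝ} (hε : 0 < ε) :
    ∃ X Q : ℕ, 0 < X ∧ ∀ m : ℕ × ℕ → ℕ, (∀ p, m p ∈ Icc 1 M) →
      ∃ r : ℕ, 0 < r ∧ r ≤ Q ∧ ∀ z : ℂ, ‖z‖ = 1 →
        η ≤ ‖squareAvg X (fun p => m p * (p.1 + p.2 + 1)) z‖ → ‖z ^ (r ^ 2) - 1‖ ≤ ε := by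
  obtain ⟨K, q, hq, C, hC, hcover⟩ := exists_spectrum_cover hη hM
  have hq0 : (0 : ℝ) < q := by exact_mod_cast hq
  obtain ⟨Q, hQ⟩ := exists_bounded_simultaneous_square_recurrence K (ε / (2 * q ^ 2))
    (by positivity)
  obtain ⟨X, hX⟩ := exists_nat_gt (2 * q * Q ^ 2 * C / ε)
  have hX0 : (0 : ℝ) < X := lt_of_le_of_lt (by positivity) hX
  have hXpos : 0 < X := by exact_mod_cast hX0
  refine ⟨X, q * Q, hXpos, fun m hm => ?_⟩
  obtain ⟨Z, hZK, hZ1, hZ⟩ := hcover X hXpos m hm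
  obtain ⟨r, hr, hrQ, hrZ⟩ := hQ Z hZK hZ1
  -- With z = u·w and w in Z, the factor q controls u, with an error made small by taking X large
  -- after Q, while r controls w.
  refine ⟨q * r, by positivity, by gcongr, fun z hz hzl => ?_⟩
  obtain ⟨w, hw, hzw⟩ := hZ z hz hzl
  have hw1 := hZ1 w hw
  have hu1 : ‖z * conj w‖ = 1 := by simp [hz, hw1]
  have hzu : z = (z * conj w) * w := by
    have := mul_conj_eq_one hw1
    linear_combination (-z) * this
  set u := z * conj w
  have h1 : ‖u ^ ((q * r) ^ 2) - 1‖ ≤ ε / 2 := by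
    have : u ^ ((q * r) ^ 2) = (u ^ q) ^ (q * r ^ 2) := by rw [← pow_mul]; congr 1; ring
    rw [this]
    refine (norm_pow_sub_one_le (by simp [hu1]) _).trans ?_
    calc ((q * r ^ 2 : ℕ) : ℝ) * ‖u ^ q - 1‖ ≤ (q * Q ^ 2 : ℕ) * (C / X) := by gcongr
      _ ≤ ε / 2 := by
        rw [div_lt_iff₀ hε] at hX
        rw [mul_div_assoc', div_le_iff₀ hX0]
        push_cast; linarith
  have h2 : ‖w ^ ((q * r) ^ 2) - 1‖ ≤ ε / 2 := by
    have : w ^ ((q * r) ^ 2) = (w ^ (r ^ 2)) ^ (q ^ 2) := by rw [← pow_mul]; congr 1; ring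
    rw [this]
    refine (norm_pow_sub_one_le (by simp [hw1]) _).trans ?_
    calc ((q ^ 2 : ℕ) : ℝ) * ‖w ^ (r ^ 2) - 1‖ ≤ (q ^ 2 : ℕ) * (ε / (2 * q ^ 2)) := by
          gcongr; exact hrZ w hw
      _ = ε / 2 := by push_cast; field_simp
  calc ‖z ^ ((q * r) ^ 2) - 1‖
      = ‖(u ^ ((q * r) ^ 2) - 1) * w ^ ((q * r) ^ 2) + (w ^ ((q * r) ^ 2) - 1)‖ := by
        rw [hzu, mul_pow]; congr 1; ring
    _ ≤ ‖(u ^ ((q * r) ^ 2) - 1) * w ^ ((q * r) ^ 2)‖ + ‖w ^ ((q * r) ^ 2) - 1‖ :=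
        norm_add_le _ _
    _ = ‖u ^ ((q * r) ^ 2) - 1‖ + ‖w ^ ((q * r) ^ 2) - 1‖ := by
        rw [norm_mul]; simp [hw1]
    _ ≤ ε := by linarith

/-! ### Chains of square averages -/

theorem norm_squareAvg_le_one (X : ℕ) (b : ℕ × ℕ → ℕ) {z : ℂ} (hz : ‖z‖ = 1) :
    ‖squareAvg X b z‖ ≤ 1 := by
  rw [squareAvg, norm_div, norm_pow, Complex.norm_natCast]
  refine div_le_one_of_le₀ ((norm_sum_le _ _).trans ?_) (by positivity)
  simp [hz, card_product, sq]

theorem norm_squareAvg_sub_one_le {X Y : ℕ} (hX : 0 < X) {b : ℕ × ℕ → ℕ}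
    (hb : ∀ p ∈ range X ×ˢ range X, b p ≤ Y) {z : ℂ} (hz : ‖z‖ = 1) :
    ‖squareAvg X b z - 1‖ ≤ (Y : ℝ) ^ 2 * ‖z - 1‖ := by
  have hX0 : (X : ℂ) ^ 2 ≠ 0 := pow_ne_zero _ (by exact_mod_cast hX.ne')
  have h1 : squareAvg X b z - 1 =
      (∑ p ∈ range X ×ˢ range X, (z ^ (b p ^ 2) - 1)) / (X : ℂ) ^ 2 := by
    rw [squareAvg, sum_sub_distrib, sub_div]
    congr 1
    simp only [sum_const, card_product, card_range, nsmul_eq_mul]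
    push_cast
    rw [← sq, mul_one, div_self hX0]
  rw [h1, norm_div, norm_pow, Complex.norm_natCast, div_le_iff₀ (by positivity)]
  calc ‖∑ p ∈ range X ×ˢ range X, (z ^ (b p ^ 2) - 1)‖
      ≤ ∑ p ∈ range X ×ˢ range X, (Y : ℝ) ^ 2 * ‖z - 1‖ := by
        refine norm_sum_le_of_le _ fun p hp => (norm_pow_sub_one_le hz _).trans ?_
        have := hb p hp
        push_cast
        gcongr
    _ = _ := by simp [card_product]; ring

theorem squareAvg_mul (X r : ℕ) (b : ℕ × ℕ → ℕ) (z : ℂ) :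
    squareAvg X (fun p => r * b p) z = squareAvg X b (z ^ (r ^ 2)) := by
  simp only [squareAvg, mul_pow, pow_mul]

theorem IsHomogeneousSet.dilate {M : ℕ} {B : Set ℕ} (hB : IsHomogeneousSet M B) {r : ℕ}
    (hr : 0 < r) : IsHomogeneousSet M {n | r * n ∈ B} := by
  refine ⟨fun n hn => Nat.pos_of_mul_pos_left (hB.1 _ hn), fun q hq => ?_⟩
  obtain ⟨n, hn, m, hm, rfl⟩ := hB.2 (r * q) (by positivity)
  exact ⟨q * m, by simpa [mul_assoc] using hn, m, hm, rfl⟩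

/-- A sequence of averages over a homogeneous set such that wherever one of them is large, all the
later ones are close to `1`. -/
theorem exists_squareAvg_chain {η : ℝ} (hη : 0 < η) {M : ℕ} (hM : 0 < M) (k : ℕ) :
    ∃ (Y : ℕ) (X : ℕ → ℕ), (∀ j, 0 < X j) ∧ ∀ B, IsHomogeneousSet M B →
      ∃ b : ℕ → ℕ × ℕ → ℕ,
        (∀ j < k, ∀ p ∈ range (X j) ×ˢ range (X j), b j p ∈ B ∧ b j p ≤ Y) ∧
        ∀ z : ℂ, ‖z‖ = 1 → ∀ j j', j < j' → j' < k →
          η ≤ ‖squareAvg (X j) (b j) z‖ → ‖squareAvg (X j') (b j') z - 1‖ ≤ η := by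
  induction k with
  | zero => exact ⟨0, fun _ => 1, fun _ => one_pos, fun _ _ => ⟨fun _ _ => 0, by simp, by simp⟩⟩
  | succ k ih =>
    obtain ⟨Y, X, hX, hchain⟩ := ih
    -- The later averages involve elements up to Y, which magnify the error by Y²; the +1 avoids
    -- division by zero.
    obtain ⟨X₀, Q, hX₀, hspec⟩ := exists_square_power_near_one_on_spectrum hη hM
      (ε := η / ((Y : ℝ) ^ 2 + 1)) (by positivity)
    refine ⟨M * (2 * X₀) + Q * Y, fun j => Nat.casesOn j X₀ X, fun j => ?_, fun B hB => ?_⟩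
    · cases j
      exacts [hX₀, hX _]
    have hchoose : ∀ p : ℕ × ℕ, ∃ m ∈ Icc 1 M, m * (p.1 + p.2 + 1) ∈ B := fun p => by
      obtain ⟨n, hn, m, hm, rfl⟩ := hB.2 (p.1 + p.2 + 1) (by positivity)
      exact ⟨m, hm, by rwa [mul_comm]⟩
    choose m hm hmB using hchoose
    obtain ⟨r, hr, hrQ, hrz⟩ := hspec m hm
    -- The new average goes in front; the old chain, built in the dilate of B, is multiplied by r
    -- and so is evaluated at z^(r²).
    obtain ⟨b, hb, hbc⟩ := hchain _ (hB.dilate hr)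
    refine ⟨fun j => Nat.casesOn j (fun p => m p * (p.1 + p.2 + 1)) fun i p => r * b i p, ?_, ?_⟩
    · rintro (_ | i) hi p hp
      · refine ⟨hmB p, le_add_of_le_of_nonneg (Nat.mul_le_mul (mem_Icc.1 (hm p)).2 ?_)
          (Nat.zero_le _)⟩
        have h := mem_product.1 hp
        have h1 : p.1 < X₀ := mem_range.1 h.1
        have h2 : p.2 < X₀ := mem_range.1 h.2
        omega
      · obtain ⟨h1, h2⟩ := hb i (by omega) p hp
        exact ⟨h1, le_add_of_nonneg_of_le (Nat.zero_le _) (Nat.mul_le_mul hrQ h2)⟩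
    · intro z hz j j' hjj' hj' hlarge
      obtain ⟨i', rfl⟩ : ∃ i', j' = i' + 1 := ⟨j' - 1, by omega⟩
      have hi' : i' < k := by omega
      have hzr : ‖z ^ (r ^ 2)‖ = 1 := by simp [hz]
      change ‖squareAvg (X i') (fun p => r * b i' p) z - 1‖ ≤ η
      rw [squareAvg_mul]
      rcases j with _ | i
      · have h1 := hrz z hz hlarge
        refine (norm_squareAvg_sub_one_le (hX i') (fun p hp => (hb i' hi' p hp).2) hzr).trans ?_
        calc (Y : ℝ) ^ 2 * ‖z ^ (r ^ 2) - 1‖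
            ≤ ((Y : ℝ) ^ 2 + 1) * (η / ((Y : ℝ) ^ 2 + 1)) := by gcongr; linarith
          _ = η := by field_simp
      · refine hbc _ hzr i i' (by omega) hi' ?_
        rw [← squareAvg_mul]
        exact hlarge

theorem norm_prod_sub_one_le_sum {ι : Type*} (s : Finset ι) (w : ι → ℂ)
    (hw : ∀ i ∈ s, ‖w i‖ ≤ 1) : ‖∏ i ∈ s, w i - 1‖ ≤ ∑ i ∈ s, ‖w i - 1‖ := by
  classical
  induction s using Finset.induction_on with
  | empty => simp
  | insert a s ha ih =>
    rw [prod_insert ha, sum_insert ha]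
    have h1 := ih fun i hi => hw i (mem_insert_of_mem hi)
    have h2 := hw a (mem_insert_self a s)
    calc ‖w a * ∏ i ∈ s, w i - 1‖ = ‖(w a - 1) + w a * (∏ i ∈ s, w i - 1)‖ := by congr 1; ring
      _ ≤ ‖w a - 1‖ + ‖w a‖ * ‖∏ i ∈ s, w i - 1‖ := by
        rw [← norm_mul]; exact norm_add_le _ _
      _ ≤ _ := by
        gcongr
        exact (mul_le_of_le_one_left (norm_nonneg _) h2).trans h1

/-- Before the first index where the product reaches η, each term loses at most η; that index loses
at most 1. There every factor has norm at least η, so later products are within dη ≤ 1 of 1 and have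
nonnegative real part. -/
theorem neg_le_sum_re_prod_of_chain {d k : ℕ} {η : ℝ} (hη : 0 ≤ η) (hdη : d * η ≤ 1)
    (w : ℕ → Fin d → ℂ) (hw : ∀ j i, ‖w j i‖ ≤ 1)
    (hchain : ∀ i j j', j < j' → j' < k → η ≤ ‖w j i‖ → ‖w j' i - 1‖ ≤ η) :
    -(k * η + 1) ≤ ∑ j ∈ range k, (∏ i, w j i).re := by
  classical
  have hprod : ∀ j, ‖∏ i, w j i‖ ≤ 1 := fun j => by
    rw [norm_prod]
    exact prod_le_one (fun _ _ => norm_nonneg _) fun i _ => hw j i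
  have hre : ∀ j, -‖∏ i, w j i‖ ≤ (∏ i, w j i).re := fun j =>
    (abs_le.1 (Complex.abs_re_le_norm _)).1
  by_cases hex : ∃ j, η ≤ ‖∏ i, w j i‖
  · set j₀ := Nat.find hex with hj₀
    have hfac : ∀ i, η ≤ ‖w j₀ i‖ := fun i => by
      refine (Nat.find_spec hex).trans ?_
      rw [← hj₀, norm_prod, ← mul_prod_erase _ _ (mem_univ i)]
      exact mul_le_of_le_one_right (norm_nonneg _)
        (prod_le_one (fun _ _ => norm_nonneg _) fun i _ => hw j₀ i)
    calc -(k * η + 1) ≤ ∑ j ∈ range k, (-η - if j = j₀ then 1 else 0) := by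
          rw [sum_sub_distrib, sum_ite_eq']
          simp only [sum_const, card_range, nsmul_eq_mul]
          split_ifs <;> linarith
      _ ≤ _ := by
        refine sum_le_sum fun j hj => ?_
        rcases lt_trichotomy j j₀ with h | h | h
        · rw [if_neg h.ne]
          have := not_le.1 (Nat.find_min hex h)
          linarith [hre j]
        · rw [if_pos h]
          linarith [hre j, hprod j]
        · rw [if_neg h.ne']
          have h1 := norm_prod_sub_one_le_sum univ (w j) fun i _ => hw j i
          have h2 : ∑ i, ‖w j i - 1‖ ≤ d * η := by
            refine (sum_le_sum fun i _ => hchain i j₀ j h (mem_range.1 hj) (hfac i)).trans ?_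
            simp
          have h3 := (abs_le.1 (Complex.abs_re_le_norm (∏ i, w j i - 1))).1
          rw [Complex.sub_re, Complex.one_re] at h3
          linarith
  · push Not at hex
    calc -(k * η + 1) ≤ ∑ j ∈ range k, -η := by
          simp only [sum_const, card_range, nsmul_eq_mul]; linarith
      _ ≤ _ := sum_le_sum fun j _ => by linarith [hre j, hex j]

/-! ### Fourier analysis modulo P -/

/-- The exponential sum of a set of integer vectors at a frequency in `(ℤ/Pℤ)^d`. -/
noncomputable def expSum {d P : ℕ} [NeZero P] (A : Finset (Fin d → ℤ)) (r : Fin d → ZMod P) : ℂ :=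
  ∑ x ∈ A, ∏ i, ZMod.stdAddChar (r i * (x i : ZMod P))

theorem sum_norm_expSum_sq_mul {d P : ℕ} [NeZero P] (A : Finset (Fin d → ℤ)) (v : Fin d → ℤ) :
    ∑ r : Fin d → ZMod P, (‖expSum A r‖ ^ 2 : ℂ) * ∏ i, ZMod.stdAddChar (r i * (v i : ZMod P)) =
      ∑ x ∈ A, ∑ x' ∈ A,
        if ∀ i, (P : ℤ) ∣ x i - x' i + v i then (P : ℂ) ^ d else 0 := by
  have h1 : ∀ x x' : Fin d → ℤ,
      ∑ r : Fin d → ZMod P, ∏ i, ZMod.stdAddChar (r i * ((x i - x' i + v i : ℤ) : ZMod P)) =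
        if ∀ i, (P : ℤ) ∣ x i - x' i + v i then (P : ℂ) ^ d else 0 := fun x x' => by
    have h2 := prod_univ_sum (fun _ : Fin d => (univ : Finset (ZMod P)))
      (fun i r => (ZMod.stdAddChar (r * ((x i - x' i + v i : ℤ) : ZMod P)) : ℂ))
    rw [Fintype.piFinset_univ] at h2
    rw [← h2]
    simp only [AddChar.sum_mulShift _ (ZMod.isPrimitive_stdAddChar P),
      ZMod.intCast_zmod_eq_zero_iff_dvd, ZMod.card]
    split_ifs with h
    · simp [h]
    · push Not at h
      obtain ⟨i, hi⟩ := h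
      exact prod_eq_zero (mem_univ i) (by simp [hi])
  simp_rw [← h1]
  rw [sum_congr rfl fun x _ => sum_comm, sum_comm]
  refine sum_congr rfl fun r _ => ?_
  rw [← Complex.mul_conj', expSum, map_sum, sum_mul_sum, sum_mul]
  refine sum_congr rfl fun x _ => ?_
  rw [sum_mul]
  refine sum_congr rfl fun x' _ => ?_
  rw [map_prod, ← prod_mul_distrib, ← prod_mul_distrib]
  refine prod_congr rfl fun i _ => ?_
  rw [← AddChar.map_neg_eq_conj, ← AddChar.map_add_eq_mul, ← AddChar.map_add_eq_mul]
  congr 1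
  push_cast; ring

theorem sum_norm_expSum_sq {d N P : ℕ} [NeZero P] (hNP : N ≤ P) {A : Finset (Fin d → ℤ)}
    (hA : A ⊆ grid d N) :
    ∑ r : Fin d → ZMod P, ‖expSum A r‖ ^ 2 = (P : ℝ) ^ d * A.card := by
  have h1 := sum_norm_expSum_sq_mul (P := P) A 0
  simp only [Pi.zero_apply, Int.cast_zero, mul_zero, AddChar.map_zero_eq_one, prod_const_one,
    mul_one, add_zero] at h1
  have h2 : ∀ x ∈ A, ∀ x' ∈ A, (∀ i, (P : ℤ) ∣ x i - x' i) ↔ x = x' := by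
    intro x hx x' hx'
    refine ⟨fun h => funext fun i => ?_, fun h => by simp [h]⟩
    have a := mem_Icc.1 (Fintype.mem_piFinset.1 (hA hx) i)
    have b := mem_Icc.1 (Fintype.mem_piFinset.1 (hA hx') i)
    have := Int.eq_zero_of_abs_lt_dvd (h i) (by rw [abs_lt]; omega)
    omega
  rw [sum_congr rfl fun x hx => sum_congr rfl fun x' hx' => if_congr (h2 x hx x' hx') rfl rfl] at h1
  simp only [sum_ite_eq, sum_ite_mem, inter_self, sum_const, nsmul_eq_mul] at h1
  have h3 : ((∑ r : Fin d → ZMod P, ‖expSum A r‖ ^ 2 : ℝ) : ℂ) = (P : ℝ) ^ d * A.card := by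
    push_cast; rw [h1]; ring
  exact_mod_cast h3

/-- Modulus 2N prevents wraparound, as x - x' + v has entries below 2N in absolute value. A
vanishing value means x' - x = v, so the two points swap roles. -/
theorem sum_norm_expSum_sq_mul_eq_zero {d N : ℕ} [NeZero (2 * N)] {A : Finset (Fin d → ℤ)}
    (hA : A ⊆ grid d N) {v : Fin d → ℤ} (hv : ∀ i, 0 ≤ v i ∧ v i ≤ N)
    (hno : ∀ x ∈ A, ∀ x' ∈ A, x - x' ≠ v) :
    ∑ r : Fin d → ZMod (2 * N),
      (‖expSum A r‖ ^ 2 : ℂ) * ∏ i, ZMod.stdAddChar (r i * (v i : ZMod (2 * N))) = 0 := by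
  rw [sum_norm_expSum_sq_mul]
  refine sum_eq_zero fun x hx => sum_eq_zero fun x' hx' => if_neg fun h => ?_
  refine hno x' hx' x hx (funext fun i => ?_)
  have a := mem_Icc.1 (Fintype.mem_piFinset.1 (hA hx) i)
  have b := mem_Icc.1 (Fintype.mem_piFinset.1 (hA hx') i)
  have c := hv i
  have := Int.eq_zero_of_abs_lt_dvd (h i) (by rw [abs_lt]; push_cast; omega)
  simp only [Pi.sub_apply]
  omega
end

/-! ### Conclusion -/

theorem mainTheorem7 (δ : ℝ) (hδ : 0 < δ) (d M : ℕ) (hd : 0 < d) (hM : 0 < M) :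
    ∃ N₀ : ℕ, ∀ N : ℕ, N₀ ≤ N →
      ∀ A : Finset (Fin d → ℤ), A ⊆ grid d N → δ * (N : ℝ) ^ d ≤ (A.card : ℝ) →
        ∀ B : Fin d → Set ℕ, (∀ i, IsHomogeneousSet M (B i)) →
          ∃ x ∈ A, ∃ x' ∈ A, ∃ y : Fin d → ℕ,
            (∀ i, y i ∈ B i) ∧ x - x' = fun i => ((y i : ℤ) ^ 2) := by
  have hd0 : (0 : ℝ) < d := by exact_mod_cast hd
  -- The bound 1/d serves the chain estimate; the other makes kη·2^d at most kδ/2, leaving kδ ≤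
  -- 2^(d+1) to contradict the choice of k.
  set η : ℝ := min (1 / d) (δ / 2 ^ (d + 1)) with hη_def
  have hη : 0 < η := lt_min (by positivity) (by positivity)
  have hη1 : d * η ≤ 1 := by
    have := min_le_left (1 / (d : ℝ)) (δ / 2 ^ (d + 1))
    calc d * η ≤ d * (1 / d) := by gcongr
      _ = 1 := by field_simp
  have hη2 : η * 2 ^ (d + 1) ≤ δ := (le_div_iff₀ (by positivity)).1 (min_le_right _ _)
  obtain ⟨k, hk⟩ := exists_nat_gt (2 ^ (d + 1) / δ)
  rw [div_lt_iff₀ hδ] at hk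
  obtain ⟨Y, X, hX, hchain⟩ := exists_squareAvg_chain hη hM k
  refine ⟨Y ^ 2 + 1, fun N hN A hA hAcard B hB => ?_⟩
  by_contra! hno
  have hNpos : 0 < N := by omega
  have hN0 : (0 : ℝ) < N := by exact_mod_cast hNpos
  have : NeZero (2 * N) := ⟨by omega⟩
  choose b hb hbc using fun i => hchain (B i) (hB i)
  set z : (Fin d → ZMod (2 * N)) → Fin d → ℂ := fun r i => ZMod.stdAddChar (r i) with hz_def
  have hz : ∀ r i, ‖z r i‖ = 1 := fun r i => AddChar.norm_apply _ _
  set F : (Fin d → ZMod (2 * N)) → ℝ := fun r => ‖expSum A r‖ ^ 2 with hF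
  have hF0 : ∀ r, 0 ≤ F r := fun r => by positivity
  set W : (Fin d → ZMod (2 * N)) → ℕ → Fin d → ℂ :=
    fun r j i => squareAvg (X j) (b i j) (z r i) with hW
  have hzero : ∀ j ∈ Finset.range k, ∑ r, (F r : ℂ) * ∏ i, W r j i = 0 := by
    intro j hj
    have hj := Finset.mem_range.1 hj
    have h1 : ∀ r, ∏ i, W r j i = (∑ p ∈ Fintype.piFinset fun _ : Fin d =>
        Finset.range (X j) ×ˢ Finset.range (X j), ∏ i, z r i ^ (b i j (p i) ^ 2)) /
          ((X j : ℂ) ^ 2) ^ d := fun r => by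
      rw [← Finset.prod_univ_sum _ fun i q => z r i ^ (b i j q ^ 2)]
      simp [hW, squareAvg, Finset.prod_div_distrib]
    simp_rw [h1, mul_div_assoc', Finset.mul_sum]
    rw [← Finset.sum_div, Finset.sum_comm, Finset.sum_eq_zero, zero_div]
    intro p hp
    have hp := Fintype.mem_piFinset.1 hp
    have h2 := sum_norm_expSum_sq_mul_eq_zero hA (v := fun i => ((b i j (p i) : ℤ) ^ 2))
      (fun i => ⟨by positivity, by
        have h3 := Nat.pow_le_pow_left (hb i j hj (p i) (hp i)).2 2
        have h4 : b i j (p i) ^ 2 ≤ N := by omega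
        exact_mod_cast h4⟩)
      (fun x hx x' hx' => hno x hx x' hx' (fun i => b i j (p i))
        fun i => (hb i j hj (p i) (hp i)).1)
    rw [← h2]
    refine Finset.sum_congr rfl fun r _ => ?_
    simp only [hF, hz_def]
    push_cast
    congr 1
    refine Finset.prod_congr rfl fun i _ => ?_
    rw [← AddChar.map_nsmul_eq_pow, nsmul_eq_mul, mul_comm (Nat.cast _)]
    push_cast
    rfl
  have htotal : ∑ r, F r * ∑ j ∈ Finset.range k, (∏ i, W r j i).re = 0 := by
    simp_rw [Finset.mul_sum]
    rw [Finset.sum_comm]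
    refine Finset.sum_eq_zero fun j hj => ?_
    have := congrArg Complex.re (hzero j hj)
    simpa [Complex.re_sum, Complex.re_ofReal_mul] using this
  have hlower : ∀ r, -(k * η + 1) ≤ ∑ j ∈ Finset.range k, (∏ i, W r j i).re := fun r =>
    neg_le_sum_re_prod_of_chain hη.le hη1 (W r) (fun j i => norm_squareAvg_le_one _ _ (hz r i))
      fun i j j' hjj' hj' h => hbc i _ (hz r i) j j' hjj' hj' h
  have hW0 : ∑ j ∈ Finset.range k, (∏ i, W 0 j i).re = k := by
    have : ∀ j i, W 0 j i = 1 := fun j i => by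
      have := norm_squareAvg_sub_one_le (Y := Finset.sup (Finset.range (X j) ×ˢ Finset.range (X j))
        (b i j)) (hX j) (fun p hp => Finset.le_sup hp) (hz 0 i)
      have hz0 : z 0 i = 1 := by simp [hz_def]
      rw [hz0] at this
      simp only [sub_self, norm_zero, mul_zero] at this
      rw [← sub_eq_zero, ← norm_le_zero_iff]
      simpa [hW, hz0] using this
    simp [this]
  have hF00 : F 0 = (A.card : ℝ) ^ 2 := by simp [hF, expSum]
  have hineq : (k : ℝ) * (A.card : ℝ) ^ 2 ≤ (k * η + 1) * ∑ r, F r := by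
    -- The shift by kη + 1 makes every term nonnegative, so frequency 0 alone bounds the sum from
    -- below.
    have h1 : F 0 * (∑ j ∈ Finset.range k, (∏ i, W 0 j i).re + (k * η + 1)) ≤
        ∑ r, F r * (∑ j ∈ Finset.range k, (∏ i, W r j i).re + (k * η + 1)) :=
      Finset.single_le_sum (f := fun r =>
        F r * (∑ j ∈ Finset.range k, (∏ i, W r j i).re + (k * η + 1)))
        (fun r _ => mul_nonneg (hF0 r) (by linarith [hlower r])) (Finset.mem_univ _)
    simp only [mul_add (F _) _ (_ : ℝ), Finset.sum_add_distrib, ← Finset.sum_mul] at h1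
    rw [htotal, hW0, hF00] at h1
    have : 0 ≤ (A.card : ℝ) ^ 2 * (k * η + 1) := by positivity
    linarith
  rw [sum_norm_expSum_sq (by omega) hA] at hineq
  have hApos : (0 : ℝ) < A.card := lt_of_lt_of_le (by positivity) hAcard
  have h2 : (k : ℝ) * A.card ≤ (k * η + 1) * (2 * N) ^ d := by
    refine le_of_mul_le_mul_right ?_ hApos
    push_cast at hineq
    linarith
  have h3 : (N : ℝ) ^ d * (k * δ) ≤ (N : ℝ) ^ d * ((k * η + 1) * 2 ^ d) := by
    calc (N : ℝ) ^ d * (k * δ) = k * (δ * N ^ d) := by ring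
      _ ≤ k * A.card := by gcongr
      _ ≤ _ := h2
      _ = _ := by rw [mul_pow]; ring
  have h4 := le_of_mul_le_mul_left h3 (by positivity)
  have h5 : (k : ℝ) * (η * 2 ^ (d + 1)) ≤ k * δ := by gcongr
  rw [pow_succ] at h5 hk
  linarith
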